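/- Conventions. A graph is a connected, locally finite simplicial graph without loops and multiple edges, equipped with the geodesic metric $d$ in which every edge has length $1$; $x\in X$ means that $x$ is a vertex of $X$, radii are non-negative integers, and $B_X(x,R)$ is the closed ball of radius $R$ in this metric graph, equipped with its own intrinsic geodesic metric (so an edge whose two endpoints both lie at distance $R$ from $x$ does not belong to $B_X(x,R)$). An isometry $B_X(x,R)\to B_Y(y,R)$ is a bijection between the vertex sets which preserves the intrinsic metrics and sends $x$ to $y$. A graph $Y$ is $R$-locally $X$ if for every $y\in Y$ there are $x\in X$ and an isometry $B_X(x,R)\to B_Y(y,R)$. A covering $X\to Y$ is a surjective map between the vertex sets which maps the set of neighbours of each vertex bijectively onto the set of neighbours of its image. For $r\le R$, the graph $X$ is USLG-rigid at scales $(r,R)$ if for every graph $Y$ which is $R$-locally $X$ and every isometry $f:B_X(x,R)\to B_Y(y,R)$ there is exactly one covering $X\to Y$ which coincides with $f$ on the vertices of $B_X(x,r)$. The graph $X$ is USLG-rigid if for all large enough $r$ there is $R\ge r$ such that $X$ is USLG-rigid at scales $(r,R)$. For $k\in\mathbf N$, let $P_k(X)$ be the polygonal $2$-complex with $1$-skeleton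 $X$ obtained by gluing an $m$-gon along every simple loop of length $m$ in $X$, for all $m\le k$. The graph $X$ is large-scale simply connected if $P_k(X)$ is simply connected for some $k$, i.e. every closed edge path of $X$ can be turned into a constant path by finitely many insertions and deletions of backtracks and of simple loops of length at most $k$. Let $\mathrm{Isom}(X)$ be the group of isometries of the vertex set of $X$ (equivalently, of automorphisms of $X$), with the topology of pointwise convergence; it is cocompact if it has finitely many orbits of vertices. Theorem. Let $X$ be a connected, large-scale simply connected graph of finite valency whose isometry group is cocompact. Then the following are equivalent: (1) $X$ is USLG-rigid; (2) all vertex stabilizers of $\mathrm{Isom}(X)$ are finite; (3) $\mathrm{Isom}(X)$ is discrete. More precisely, if $\mathrm{Isom}(X)$ is discrete, then there is an integer $r_c\ge 0$ such that any two elements of $\mathrm{Isom}(X)$ which coincide on some ball $B_X(x,r_c)$ are equal; and for every such $r_c$ there is an integer $C>0$ such that $X$ is USLG-rigid at scales $(r,r+C)$ for every integer $r\ge r_c$. -/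

import Mathlib

universe u v

namespace LocalGlobal

/-! A graph is given by its vertex set and its adjacency relation; its geodesic metric, restricted
to the vertices, is `SimpleGraph.dist`. -/

section Balls

variable {V : Type u} {W : Type v}

/-- The vertices of the closed ball of radius `R` centred at the vertex `x`. -/
def ball (X : SimpleGraph V) (x : V) (R : ℕ) : Set V :=
  {u | X.dist x u ≤ R}

theorem center_mem_ball (X : SimpleGraph V) (x : V) (R : ℕ) : x ∈ ball X x R := by
  simp [ball]

/-- The closed ball of integer radius `R` centred at `x` in the metric graph (every edge is a
segment of length `1`), as a graph. An edge both of whose endpoints are at distance exactly `R`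
from `x` is not contained in this ball, as its midpoint is at distance `R + 1/2` from `x`. -/
def ballGraph (X : SimpleGraph V) (x : V) (R : ℕ) : SimpleGraph (ball X x R) where
  Adj u w := X.Adj u w ∧ (X.dist x u < R ∨ X.dist x w < R)
  symm := ⟨fun _ _ h => ⟨h.1.symm, h.2.symm⟩⟩
  loopless := ⟨fun _ h => X.irrefl h.1⟩

/-- `f` is an isometry from the ball of radius `R` around `x` onto the ball of radius `R` around
`y` (centre to centre), both balls being equipped with their intrinsic geodesic metrics. -/
def IsBallIsometry (X : SimpleGraph V) (Y : SimpleGraph W) (x : V) (y : W) (R : ℕ)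
    (f : ball X x R ≃ ball Y y R) : Prop :=
  (f ⟨x, center_mem_ball X x R⟩ : W) = y ∧
    ∀ u w : ball X x R, (ballGraph Y y R).dist (f u) (f w) = (ballGraph X x R).dist u w

/-- `Y` is `R`-locally `X`. -/
def IsLocally (R : ℕ) (X : SimpleGraph V) (Y : SimpleGraph W) : Prop :=
  ∀ y : W, ∃ (x : V) (f : ball X x R ≃ ball Y y R), IsBallIsometry X Y x y R f

/-- A covering map of graphs: a surjection on vertices that maps the neighbours of every vertex
bijectively onto the neighbours of its image. -/
def IsCovering (X : SimpleGraph V) (Y : SimpleGraph W) (p : V → W) : Prop :=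
  Function.Surjective p ∧
    ∀ u : V, Set.BijOn p (X.neighborSet u) (Y.neighborSet (p u))

end Balls

section Rigidity

variable {V : Type u}

/-- `X` is USLG-rigid at scales `(r, R)` (this is used for `r ≤ R`): for every connected locally
finite graph `Y` that is `R`-locally `X` and every isometry `f` from a ball of radius `R` of `X` to
a ball of radius `R` of `Y`, the restriction of `f` to the concentric ball of radius `r` extends to
exactly one covering map from `X` to `Y`. -/
def USLGRigidAt (X : SimpleGraph V) (r R : ℕ) : Prop :=
  ∀ (W : Type u) (Y : SimpleGraph W), Y.Connected → (∀ w, (Y.neighborSet w).Finite) →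
    IsLocally R X Y →
    ∀ (x : V) (y : W) (f : ball X x R ≃ ball Y y R), IsBallIsometry X Y x y R f →
      ∃! p : V → W, IsCovering X Y p ∧
        ∀ u : ball X x R, X.dist x u ≤ r → p u = f u

/-- `X` is USLG-rigid: for all large enough `r` there is `R ≥ r` such that `X` is USLG-rigid at
scales `(r, R)`. -/
def USLGRigid (X : SimpleGraph V) : Prop :=
  ∃ r₀ : ℕ, ∀ r : ℕ, r₀ ≤ r → ∃ R : ℕ, r ≤ R ∧ USLGRigidAt X r R

end Rigidity

section SimpleConnectedness

variable {V : Type u}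

/-- Elementary homotopies of edge paths in the polygonal 2-complex `P_k(X)`, whose 1-skeleton is
`X` and which has one `m`-gon for every simple loop of length `m ≤ k` in `X`: insertion of a
backtrack, and insertion of the boundary of a 2-cell (based at any of its vertices, in either
direction). -/
inductive ElementaryHomotopy (X : SimpleGraph V) (k : ℕ) :
    ∀ {a b : V}, X.Walk a b → X.Walk a b → Prop
  | backtrack {a b c d : V} (p : X.Walk a b) (h : X.Adj b c) (q : X.Walk b d) :
      ElementaryHomotopy X k (p.append q)
        (p.append (SimpleGraph.Walk.cons h (SimpleGraph.Walk.cons h.symm q)))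
  | cell {a b d : V} (p : X.Walk a b) (l : X.Walk b b) (q : X.Walk b d) :
      l.IsCycle → l.length ≤ k →
      ElementaryHomotopy X k (p.append q) (p.append (l.append q))

/-- Homotopy, relative to the endpoints, of edge paths in `P_k(X)`. -/
def Homotopic (X : SimpleGraph V) (k : ℕ) {a b : V} (p q : X.Walk a b) : Prop :=
  Relation.EqvGen (fun p q : X.Walk a b => ElementaryHomotopy X k p q) p q

/-- `X` is `k`-simply connected: the complex `P_k(X)` is simply connected, that is, it is connected
and its edge-path fundamental group is trivial at every vertex. -/
def KSimplyConnected (X : SimpleGraph V) (k : ℕ) : Prop :=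
  X.Connected ∧ ∀ (a : V) (l : X.Walk a a), Homotopic X k l SimpleGraph.Walk.nil

/-- `X` is large-scale simply connected. -/
def LargeScaleSimplyConnected (X : SimpleGraph V) : Prop :=
  ∃ k : ℕ, KSimplyConnected X k

end SimpleConnectedness

section Isometries

variable {V : Type u}

/-- The isometry group of (the vertex set of) `X`, which is its group of graph automorphisms. -/
abbrev Isom (X : SimpleGraph V) : Type u := X ≃g X

/-- `Isom X` acts cocompactly on `X`: there are finitely many orbits of vertices. -/
def CocompactIsom (X : SimpleGraph V) : Prop :=
  Finite (MulAction.orbitRel.Quotient (Isom X) V)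

/-- All vertex stabilizers of `Isom X` are finite. -/
def FiniteStabilizers (X : SimpleGraph V) : Prop :=
  ∀ x : V, Finite (MulAction.stabilizer (Isom X) x)

/-- The usual topology of `Isom X`: pointwise convergence on the discrete set of vertices. -/
abbrev isomTopology (X : SimpleGraph V) : TopologicalSpace (Isom X) :=
  TopologicalSpace.induced (fun (g : Isom X) (x : V) => g x)
    (@Pi.topologicalSpace V (fun _ => V) (fun _ => ⊥))

/-- The isometry group of `X` is discrete. -/
def DiscreteIsom (X : SimpleGraph V) : Prop :=
  @DiscreteTopology (Isom X) (isomTopology X)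

/-- Two isometries of `X` that coincide on some ball of radius `ρ` are equal. -/
def DeterminedOnBalls (X : SimpleGraph V) (ρ : ℕ) : Prop :=
  ∀ (x : V) (g h : Isom X), (∀ u ∈ ball X x ρ, g u = h u) → g = h

end Isometries

end LocalGlobal

namespace LocalGlobal

open Set

/-! ### Maps that are isomorphisms on a ball -/

section BallIsomorphisms

variable {U V W : Type*} {X : SimpleGraph V} {Y : SimpleGraph W}

/-! Discreteness and finiteness of stabilizers both say that some finite set of vertices determines
every isometry (`FinitelyDetermined`); by cocompactness that set can be replaced by any ball of one
radius `rc`. Rigidity applied to `Y = X` and the identity gives this condition directly. Conversely,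
compactness yields `D` such that every isomorphism between `D`-balls of `X` agrees with a global
isometry on the `(rc + 1)`-ball. Hence an isomorphism from a `D`-ball of `X` to one of `Y` is
determined on the `(rc + 1)`-ball by its `rc`-germ, and this germ continues canonically to every
neighbouring centre. Since `Y` is locally `X`, the continued germ again comes from a large ball, so
continuation never stops. Short loops stay inside one large ball and have no monodromy; large-scale
simple connectedness then removes all monodromy, and evaluating the germs at their centres gives the
covering (`Rigid.exists_covering`). For uniqueness, counting points in balls shows that every
covering is a local isomorphism (`Rigid.ballIso_of_isCovering`), so its germs obey the same
continuation and are fixed by the germ at `x`. -/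

theorem exists_adj_dist_eq (hX : X.Connected) {x u : V} {n : ℕ} (h : X.dist x u = n + 1) :
    ∃ w, X.Adj w u ∧ X.dist x w = n := by
  obtain ⟨p, hp⟩ := hX.exists_walk_length_eq_dist u x
  rw [SimpleGraph.dist_comm, h] at hp
  cases p with
  | nil => simp at hp
  | @cons _ w _ huw q =>
    refine ⟨w, huw.symm, le_antisymm ?_ ?_⟩
    · rw [SimpleGraph.dist_comm]
      refine (SimpleGraph.dist_le q).trans ?_
      simp only [SimpleGraph.Walk.length_cons] at hp
      omega
    · have h1 := hX.dist_triangle (u := x) (v := w) (w := u)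
      have h2 := SimpleGraph.dist_eq_one_iff_adj.2 huw.symm
      omega

theorem dist_le_add_one (hX : X.Connected) (x : V) {u w : V} (h : X.Adj u w) :
    X.dist x w ≤ X.dist x u + 1 := by
  have h1 := hX.dist_triangle (u := x) (v := u) (w := w)
  rwa [SimpleGraph.dist_eq_one_iff_adj.2 h] at h1

theorem ball_mono (X : SimpleGraph V) (x : V) {r s : ℕ} (h : r ≤ s) : ball X x r ⊆ ball X x s :=
  fun _ hu => le_trans hu h

theorem ball_subset_ball (hX : X.Connected) {x u : V} {r s : ℕ} (h : X.dist x u + r ≤ s) :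
    ball X u r ⊆ ball X x s := fun w hw => by
  have h1 := hX.dist_triangle (u := x) (v := u) (w := w)
  simp only [ball, mem_ofPred_eq] at hw ⊢
  omega

theorem ball_finite (hX : X.Connected) (hfin : ∀ u, (X.neighborSet u).Finite) (x : V) (R : ℕ) :
    (ball X x R).Finite := by
  induction R with
  | zero =>
    refine (finite_singleton x).subset fun u hu => ?_
    simp only [ball, mem_ofPred_eq, nonpos_iff_eq_zero] at hu
    exact ((hX.dist_eq_zero_iff).1 hu).symm
  | succ n ih =>
    refine (ih.union (ih.biUnion fun u _ => hfin u)).subset fun u hu => ?_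
    rcases Nat.lt_or_ge n (X.dist x u) with h | h
    · obtain ⟨w, hw, hd⟩ := exists_adj_dist_eq hX (le_antisymm hu h)
      exact Or.inr (mem_biUnion (show w ∈ ball X x n from hd.le) hw)
    · exact Or.inl h

/-- `φ` maps the star of every vertex in the interior of the ball onto the star of its image. -/
def CoversBall (X : SimpleGraph V) (Y : SimpleGraph W) (x : V) (R : ℕ) (φ : V → W) : Prop :=
  ∀ u, X.dist x u < R → φ '' X.neighborSet u = Y.neighborSet (φ u)

/-- `φ` restricts to an isomorphism from the ball of radius `R` around `x` onto the ball of radius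
`R` around `φ x`. -/
def BallIso (X : SimpleGraph V) (Y : SimpleGraph W) (x : V) (R : ℕ) (φ : V → W) : Prop :=
  CoversBall X Y x R φ ∧ InjOn φ (ball X x R)

theorem CoversBall.dist_le (hX : X.Connected) (hY : Y.Connected) {x : V} {R : ℕ} {φ : V → W}
    (h : CoversBall X Y x R φ) {u : V} (hu : X.dist x u ≤ R) :
    Y.dist (φ x) (φ u) ≤ X.dist x u := by
  obtain ⟨n, hn⟩ : ∃ n, X.dist x u = n := ⟨_, rfl⟩
  induction n generalizing u with
  | zero =>
    obtain rfl := (hX.dist_eq_zero_iff).1 hn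
    simp
  | succ n ih =>
    obtain ⟨w, hw, hd⟩ := exists_adj_dist_eq hX hn
    have h1 := ih (u := w) (by omega) hd
    have h2 : φ u ∈ Y.neighborSet (φ w) := by
      rw [← h w (by omega)]
      exact mem_image_of_mem _ hw
    have h3 := dist_le_add_one hY (φ x) h2
    omega

/-- Geodesics issued from `φ x` lift edge by edge, so preimages can be found no farther from `x`. -/
theorem CoversBall.exists_eq (hX : X.Connected) (hY : Y.Connected) {x : V} {R : ℕ} {φ : V → W}
    (h : CoversBall X Y x R φ) {w : W} (hw : Y.dist (φ x) w ≤ R) :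
    ∃ u, X.dist x u ≤ Y.dist (φ x) w ∧ φ u = w := by
  obtain ⟨n, hn⟩ : ∃ n, Y.dist (φ x) w = n := ⟨_, rfl⟩
  induction n generalizing w with
  | zero => exact ⟨x, by simp, (hY.dist_eq_zero_iff).1 hn⟩
  | succ n ih =>
    obtain ⟨z, hz, hd⟩ := exists_adj_dist_eq hY hn
    obtain ⟨u, hu, rfl⟩ := ih (w := z) (by omega) hd
    have h1 : w ∈ Y.neighborSet (φ u) := hz
    rw [← h u (by omega)] at h1
    obtain ⟨u', hu', rfl⟩ := h1
    have := dist_le_add_one hX x hu'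
    exact ⟨u', by omega, rfl⟩

theorem BallIso.dist_eq (hX : X.Connected) (hY : Y.Connected) {x : V} {R : ℕ} {φ : V → W}
    (h : BallIso X Y x R φ) {u : V} (hu : X.dist x u ≤ R) :
    Y.dist (φ x) (φ u) = X.dist x u := by
  have h1 := h.1.dist_le hX hY hu
  obtain ⟨u', hu', he⟩ := h.1.exists_eq hX hY (h1.trans hu)
  have := h.2 (show u' ∈ ball X x R from hu'.trans (h1.trans hu)) hu he
  subst this
  omega

theorem CoversBall.image_ball (hX : X.Connected) (hY : Y.Connected) {x : V} {R : ℕ} {φ : V → W}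
    (h : CoversBall X Y x R φ) : φ '' ball X x R = ball Y (φ x) R := by
  ext w
  constructor
  · rintro ⟨u, hu, rfl⟩
    exact (h.dist_le hX hY hu).trans hu
  · intro hw
    obtain ⟨u, hu, rfl⟩ := h.exists_eq hX hY hw
    exact ⟨u, hu.trans hw, rfl⟩

theorem BallIso.restrict (hX : X.Connected) {x x' : V} {R R' : ℕ} {φ : V → W}
    (h : BallIso X Y x R φ) (hR : X.dist x x' + R' ≤ R) : BallIso X Y x' R' φ := by
  refine ⟨fun u hu => h.1 u ?_, h.2.mono (ball_subset_ball hX hR)⟩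
  have := hX.dist_triangle (u := x) (v := x') (w := u)
  omega

theorem BallIso.mono {x : V} {R R' : ℕ} {φ : V → W}
    (h : BallIso X Y x R φ) (hR : R' ≤ R) : BallIso X Y x R' φ :=
  ⟨fun u hu => h.1 u (hu.trans_le hR), h.2.mono (ball_mono X x hR)⟩

theorem BallIso.comp {Z : SimpleGraph U} (hX : X.Connected) (hY : Y.Connected) {x : V} {R : ℕ}
    {φ : V → W} {ψ : W → U} (h : BallIso X Y x R φ) (h' : BallIso Y Z (φ x) R ψ) :
    BallIso X Z x R (ψ ∘ φ) := by
  refine ⟨fun u hu => ?_, h'.2.comp h.2 fun u hu => ?_⟩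
  · rw [image_comp, h.1 u hu, h'.1 _ (by rwa [h.dist_eq hX hY hu.le]), Function.comp]
  · exact (h.dist_eq hX hY hu).le.trans hu

theorem BallIso.exists_inverse (hX : X.Connected) (hY : Y.Connected) {x : V} {R : ℕ}
    {φ : V → W} (h : BallIso X Y x R φ) :
    ∃ ψ : W → V, BallIso Y X (φ x) R ψ ∧ (∀ u ∈ ball X x R, ψ (φ u) = u) ∧
      ∀ w ∈ ball Y (φ x) R, φ (ψ w) = w := by
  have : Nonempty V := ⟨x⟩
  have hinv : ∀ u ∈ ball X x R, Function.invFunOn φ (ball X x R) (φ u) = u :=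
    fun u hu => h.2.leftInvOn_invFunOn hu
  have hsurj : ∀ w ∈ ball Y (φ x) R, ∃ u ∈ ball X x R, φ u = w := by
    intro w hw
    rwa [← h.1.image_ball hX hY] at hw
  refine ⟨Function.invFunOn φ (ball X x R), ⟨fun w hw => ?_, fun w hw w' hw' he => ?_⟩, hinv,
    fun w hw => ?_⟩
  · obtain ⟨u, hu, rfl⟩ := hsurj w (show _ ≤ _ from hw.le)
    rw [h.dist_eq hX hY hu] at hw
    rw [hinv u hu, ← h.1 u hw, ← image_comp]
    have : EqOn (Function.invFunOn φ (ball X x R) ∘ φ) id (X.neighborSet u) := fun z hz =>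
      hinv z ((dist_le_add_one hX x hz).trans hw)
    rw [this.image_eq, image_id]
  · obtain ⟨u, hu, rfl⟩ := hsurj w hw
    obtain ⟨u', hu', rfl⟩ := hsurj w' hw'
    rw [hinv u hu, hinv u' hu'] at he
    rw [he]
  · obtain ⟨u, hu, rfl⟩ := hsurj w hw
    rw [hinv u hu]

theorem BallIso.of_isom (g : X ≃g Y) (x : V) (R : ℕ) : BallIso X Y x R g := by
  refine ⟨fun u _ => ?_, g.injective.injOn⟩
  ext w
  constructor
  · rintro ⟨z, hz, rfl⟩
    exact g.map_adj_iff.2 hz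
  · intro hw
    refine ⟨g.symm w, ?_, g.apply_symm_apply w⟩
    rw [SimpleGraph.mem_neighborSet, ← g.map_adj_iff, RelIso.apply_symm_apply]
    exact hw

theorem IsCovering.coversBall {p : V → W} (hp : IsCovering X Y p) (x : V) (R : ℕ) :
    CoversBall X Y x R p := fun u _ => (hp.2 u).image_eq

theorem surjective_of_image_neighborSet (hX : X.Connected) (hY : Y.Connected) {p : V → W}
    (h : ∀ u, p '' X.neighborSet u = Y.neighborSet (p u)) : Function.Surjective p := by
  intro w
  obtain ⟨x⟩ := hX.nonempty
  have hc : CoversBall X Y x (Y.dist (p x) w) p := fun u _ => h u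
  obtain ⟨u, -, hu⟩ := hc.exists_eq hX hY le_rfl
  exact ⟨u, hu⟩

theorem exists_isom_of_injective (hX : X.Connected) {p : V → V} (hp : Function.Injective p)
    (h : ∀ u, p '' X.neighborSet u = X.neighborSet (p u)) : ∃ g : X ≃g X, ∀ u, g u = p u := by
  refine ⟨⟨Equiv.ofBijective p ⟨hp, surjective_of_image_neighborSet hX hX h⟩, ?_⟩, fun _ => rfl⟩
  intro a b
  change X.Adj (p a) (p b) ↔ X.Adj a b
  constructor
  · intro hab
    have h1 : p b ∈ X.neighborSet (p a) := hab
    rw [← h a] at h1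
    obtain ⟨c, hc, he⟩ := h1
    rw [← hp he]
    exact hc
  · intro hab
    have h1 : p b ∈ X.neighborSet (p a) := by
      rw [← h a]
      exact mem_image_of_mem _ hab
    exact h1

/-! Ball isometries in the intrinsic metrics are ball isomorphisms. -/

/-- Every edge of a geodesic from the centre has an endpoint at distance less than `R`, so the
geodesic survives in `ballGraph`. -/
theorem dist_ballGraph_center (hX : X.Connected) (x : V) (R : ℕ) (u : ball X x R) :
    (ballGraph X x R).Reachable ⟨x, center_mem_ball X x R⟩ u ∧
      (ballGraph X x R).dist ⟨x, center_mem_ball X x R⟩ u = X.dist x u := by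
  have key : ∀ n, ∀ u : ball X x R, X.dist x u = n →
      ∃ p : (ballGraph X x R).Walk ⟨x, center_mem_ball X x R⟩ u, p.length = n := by
    intro n
    induction n with
    | zero =>
      rintro ⟨u, hu⟩ hn
      obtain rfl := (hX.dist_eq_zero_iff).1 hn
      exact ⟨SimpleGraph.Walk.nil, rfl⟩
    | succ n ih =>
      rintro ⟨u, hu⟩ hn
      obtain ⟨w, hw, hd⟩ := exists_adj_dist_eq hX hn
      have hR : n + 1 ≤ R := hn ▸ hu
      have hwb : w ∈ ball X x R := show X.dist x w ≤ R by omega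
      obtain ⟨p, hp⟩ := ih ⟨w, hwb⟩ hd
      have hadj : (ballGraph X x R).Adj ⟨w, hwb⟩ ⟨u, hu⟩ :=
        ⟨hw, Or.inl (by simp only; omega)⟩
      exact ⟨p.concat hadj, by simp [hp]⟩
  obtain ⟨p, hp⟩ := key _ u rfl
  refine ⟨⟨p⟩, le_antisymm (hp ▸ SimpleGraph.dist_le p) ?_⟩
  obtain ⟨q, hq⟩ := (show (ballGraph X x R).Reachable _ _ from ⟨p⟩).exists_walk_length_eq_dist
  let i : ballGraph X x R →g X := ⟨Subtype.val, fun h => h.1⟩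
  rw [← hq, ← SimpleGraph.Walk.length_map i q]
  exact SimpleGraph.dist_le (q.map i)

/-- Intrinsic distance one is adjacency in `ballGraph`, which contains the full star of each
interior vertex; distances to the centre are preserved, so interior vertices correspond. -/
theorem IsBallIsometry.exists_ballIso (hX : X.Connected) (hY : Y.Connected) {x : V} {y : W}
    {R : ℕ} {f : ball X x R ≃ ball Y y R} (hf : IsBallIsometry X Y x y R f) :
    ∃ φ : V → W, BallIso X Y x R φ ∧ φ x = y ∧ ∀ u : ball X x R, φ u = f u := by
  classical
  obtain ⟨φ, hφ⟩ : ∃ φ : V → W, ∀ u : ball X x R, φ u = f u :=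
    ⟨fun u => if h : u ∈ ball X x R then f ⟨u, h⟩ else y, fun u => by simp⟩
  have hx : φ x = y := (hφ ⟨x, center_mem_ball X x R⟩).trans hf.1
  have hadj : ∀ u w, (ballGraph Y y R).Adj (f u) (f w) ↔ (ballGraph X x R).Adj u w := fun u w => by
    rw [← SimpleGraph.dist_eq_one_iff_adj, hf.2, SimpleGraph.dist_eq_one_iff_adj]
  have hd : ∀ u : ball X x R, Y.dist y (f u) = X.dist x u := fun u => by
    rw [← (dist_ballGraph_center hX x R u).2, ← (dist_ballGraph_center hY y R (f u)).2, ← hf.2]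
    congr 1
    exact (Subtype.ext hf.1).symm
  refine ⟨φ, ⟨fun u hu => ?_, fun u hu w hw he => ?_⟩, hx, hφ⟩
  · have hφu := hφ ⟨u, hu.le⟩
    ext w
    constructor
    · rintro ⟨z, hz, rfl⟩
      have hzb : z ∈ ball X x R := (dist_le_add_one hX x hz).trans hu
      have := (hadj ⟨u, hu.le⟩ ⟨z, hzb⟩).2 ⟨hz, Or.inl hu⟩
      rw [hφu, hφ ⟨z, hzb⟩]
      exact this.1
    · intro hw
      rw [hφu] at hw
      have hu' : Y.dist y (f ⟨u, hu.le⟩) < R := by rwa [hd]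
      have hwb : w ∈ ball Y y R := (dist_le_add_one hY y hw).trans hu'
      have h1 := hφ (f.symm ⟨w, hwb⟩)
      have h2 := hadj ⟨u, hu.le⟩ (f.symm ⟨w, hwb⟩)
      rw [f.apply_symm_apply] at h1 h2
      exact ⟨_, (h2.1 ⟨hw, Or.inl hu'⟩).1, h1⟩
  · have h1 := hφ ⟨u, hu⟩
    have h2 := hφ ⟨w, hw⟩
    simp only at h1 h2
    rw [h1, h2] at he
    exact congrArg Subtype.val (f.injective (Subtype.ext he))

theorem IsLocally.exists_ballIso (hX : X.Connected) (hY : Y.Connected) {R : ℕ}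
    (h : IsLocally R X Y) (y : W) : ∃ (x : V) (φ : V → W), BallIso X Y x R φ ∧ φ x = y := by
  obtain ⟨x, f, hf⟩ := h y
  obtain ⟨φ, h1, h2, -⟩ := hf.exists_ballIso hX hY
  exact ⟨x, φ, h1, h2⟩

end BallIsomorphisms

/-! ### Compactness: extending ball isomorphisms to isometries -/

section Extension

variable {V : Type*} {X : SimpleGraph V}

theorem CocompactIsom.exists_finite {V : Type u} {X : SimpleGraph V} (h : CocompactIsom X) :
    ∃ F : Set V, F.Finite ∧ ∀ v, ∃ a ∈ F, ∃ g : X ≃g X, g v = a := by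
  have : Finite (MulAction.orbitRel.Quotient (Isom X) V) := h
  refine ⟨range (Quotient.out : MulAction.orbitRel.Quotient (Isom X) V → V), finite_range _,
    fun v => ⟨_, ⟨Quotient.mk _ v, rfl⟩, ?_⟩⟩
  have h1 : (MulAction.orbitRel (Isom X) V) (Quotient.out (Quotient.mk _ v)) v :=
    Quotient.mk_out v
  obtain ⟨g, hg⟩ := h1
  exact ⟨g, hg⟩

/-- Compactness: an isomorphism between large balls coincides on a smaller ball with a global
isometry. -/
theorem exists_extension_radius_at (hX : X.Connected) (hfin : ∀ u, (X.neighborSet u).Finite)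
    {F : Set V} (hF : F.Finite) (hFX : ∀ v, ∃ a ∈ F, ∃ g : X ≃g X, g v = a) (v : V) (ρ : ℕ) :
    ∃ D, ∀ φ : V → V, BallIso X X v D φ → ∃ g : X ≃g X, ∀ u ∈ ball X v ρ, g u = φ u := by
  by_contra! hcon
  choose φ hφ hne using hcon
  -- Counterexamples on balls of every radius `n` are translated so that the image of the centre
  -- lies in the finite set `F`.
  choose a ha g hg using fun n => hFX (φ n v)
  have hΦ : ∀ n, BallIso X X v n (g n ∘ φ n) := fun n =>
    (hφ n).comp hX hX (BallIso.of_isom (g n) _ _)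
  have hlarge : ∀ m : ℕ, ∀ᶠ n in (Filter.hyperfilter ℕ : Filter ℕ), m ≤ n := fun m =>
    (Nat.hyperfilter_le_atTop (Filter.eventually_ge_atTop m))
  -- Each vertex has only finitely many possible images, so a limit along a nonprincipal ultrafilter
  -- replaces diagonal extraction.
  have hlim : ∀ w, ∃ z, ∀ᶠ n in (Filter.hyperfilter ℕ : Filter ℕ), (g n ∘ φ n) w = z := by
    intro w
    have hK : (⋃ b ∈ F, ball X b (X.dist v w)).Finite :=
      hF.biUnion fun b _ => ball_finite hX hfin b _
    have hmem : (⋃ z ∈ ⋃ b ∈ F, ball X b (X.dist v w), {n | (g n ∘ φ n) w = z}) ∈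
        Filter.hyperfilter ℕ := by
      filter_upwards [hlarge (X.dist v w)] with n hn
      refine mem_biUnion (x := (g n ∘ φ n) w) (mem_biUnion (ha n) ?_) rfl
      have := ((hΦ n).dist_eq hX hX hn).le
      simp only [Function.comp, hg] at this
      exact this
    obtain ⟨z, -, hz⟩ := (Ultrafilter.finite_biUnion_mem_iff hK).1 hmem
    exact ⟨z, hz⟩
  choose L hL using hlim
  have hLset : ∀ S : Set V, S.Finite →
      ∀ᶠ n in (Filter.hyperfilter ℕ : Filter ℕ), EqOn (g n ∘ φ n) L S := fun S hS =>
    (Filter.eventually_all_finite hS).2 fun w _ => hL w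
  have hinj : Function.Injective L := by
    intro b c hbc
    obtain ⟨n, h1, h2, h3, h4⟩ := ((hL b).and ((hL c).and
      ((hlarge (X.dist v b)).and (hlarge (X.dist v c))))).exists
    exact (hΦ n).2 h3 h4 (by rw [h1, h2, hbc])
  have hcov : ∀ u, L '' X.neighborSet u = X.neighborSet (L u) := by
    intro u
    obtain ⟨n, h1, h2, h3⟩ := ((hL u).and ((hLset _ (hfin u)).and
      (hlarge (X.dist v u + 1)))).exists
    rw [← h1, ← (hΦ n).1 u h3, h2.image_eq]
  obtain ⟨γ, hγ⟩ := exists_isom_of_injective hX hinj hcov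
  obtain ⟨n, hn⟩ := (hLset _ (ball_finite hX hfin v ρ)).exists
  -- Undoing the translation `g n` turns the limit into an isometry that agrees with `φ n` on the
  -- `ρ`-ball.
  obtain ⟨u, hu, hu'⟩ := hne n (γ.trans (g n).symm)
  refine hu' ?_
  simp only [RelIso.trans_apply, hγ, ← hn hu, Function.comp, RelIso.symm_apply_apply]

/-- Conjugating by isometries reduces to finitely many centres, which makes the radius uniform. -/
theorem exists_extension_radius (hX : X.Connected) (hfin : ∀ u, (X.neighborSet u).Finite)
    {F : Set V} (hF : F.Finite) (hFX : ∀ v, ∃ a ∈ F, ∃ g : X ≃g X, g v = a) (ρ : ℕ) :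
    ∃ D, ρ ≤ D ∧ ∀ (v : V) (φ : V → V), BallIso X X v D φ →
      ∃ g : X ≃g X, ∀ u ∈ ball X v ρ, g u = φ u := by
  choose D hD using fun v => exists_extension_radius_at hX hfin hF hFX v ρ
  obtain ⟨E, hE⟩ := (hF.image D).bddAbove
  refine ⟨max ρ E, le_max_left _ _, fun v φ hφ => ?_⟩
  obtain ⟨a, ha, g, hg⟩ := hFX v
  have hga : g.symm a = v := by rw [← hg, RelIso.symm_apply_apply]
  have h1 : BallIso X X a (D a) (φ ∘ g.symm) := by
    refine BallIso.comp hX hX (BallIso.of_isom g.symm a _) ?_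
    rw [hga]
    exact hφ.mono ((hE (mem_image_of_mem _ ha)).trans (le_max_right _ _))
  obtain ⟨h, hh⟩ := hD a _ h1
  refine ⟨g.trans h, fun u hu => ?_⟩
  have h2 : g u ∈ ball X a ρ := by
    have := (BallIso.of_isom g v ρ).dist_eq hX hX hu
    rw [hg] at this
    exact this.le.trans hu
  rw [RelIso.trans_apply, hh _ h2, Function.comp, RelIso.symm_apply_apply]

end Extension

/-! ### Transport along edge paths and monodromy -/

section Monodromy

variable {V : Type u} {X : SimpleGraph V} {A : Type*}

/-- Transport along an edge path. -/
def transport (T : V → V → A → A) : ∀ {a b : V}, X.Walk a b → A → A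
  | _, _, .nil, e => e
  | a, _, .cons (v := c) _ p, e => transport T p (T a c e)

theorem transport_append (T : V → V → A → A) {a b c : V} (p : X.Walk a b) (q : X.Walk b c)
    (e : A) : transport T (p.append q) e = transport T q (transport T p e) := by
  induction p generalizing e with
  | nil => rfl
  | cons h p ih => exact ih q _

theorem transport_mem {T : V → V → A → A} {P : V → A → Prop}
    (hP : ∀ a b e, X.Adj a b → P a e → P b (T a b e)) {a b : V} (p : X.Walk a b) {e : A}
    (he : P a e) : P b (transport T p e) := by
  induction p generalizing e with
  | nil => exact he
  | cons h p ih => exact ih (hP _ _ _ h he)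

theorem transport_eq_of_localSection {T : V → V → A → A} {s : V → A} {S : Set V}
    (hs : ∀ a b, X.Adj a b → a ∈ S → b ∈ S → T a b (s a) = s b) {a b : V} (p : X.Walk a b)
    (hp : ∀ u ∈ p.support, u ∈ S) : transport T p (s a) = s b := by
  induction p with
  | nil => rfl
  | cons h p ih =>
    rw [transport, hs _ _ h (hp _ (by simp)) (hp _ (by simp))]
    exact ih fun u hu => hp u (by simp [hu])

theorem transport_homotopic {T : V → V → A → A} {P : V → A → Prop} {k : ℕ}
    (hP : ∀ a b e, X.Adj a b → P a e → P b (T a b e))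
    (hT : ∀ a b e, X.Adj a b → P a e → T b a (T a b e) = e)
    (hc : ∀ a e (l : X.Walk a a), P a e → l.length ≤ k → transport T l e = e) {a b : V}
    {p q : X.Walk a b} (h : Homotopic X k p q) {e : A} (he : P a e) :
    transport T p e = transport T q e := by
  induction h with
  | rel p q h =>
    cases h with
    | backtrack p h q =>
      have := transport_mem hP p he
      simp only [transport_append, transport]
      rw [hT _ _ _ h this]
    | cell p l q _ hl =>
      have := transport_mem hP p he
      simp only [transport_append]
      rw [hc _ _ l this hl]
  | refl p => rfl
  | symm p q _ ih => exact ih.symm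
  | trans p q r _ _ ih1 ih2 => exact ih1.trans ih2

/-- On a `k`-simply connected graph, transport without monodromy along loops of length at most `k`
has global sections. -/
theorem exists_section {T : V → V → A → A} {P : V → A → Prop} {k : ℕ}
    (hX : KSimplyConnected X k)
    (hP : ∀ a b e, X.Adj a b → P a e → P b (T a b e))
    (hT : ∀ a b e, X.Adj a b → P a e → T b a (T a b e) = e)
    (hc : ∀ a e (l : X.Walk a a), P a e → l.length ≤ k → transport T l e = e)
    (x : V) {e : A} (he : P x e) :
    ∃ s : V → A, s x = e ∧ (∀ v, P v (s v)) ∧ ∀ a b, X.Adj a b → T a b (s a) = s b := by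
  have hloop : ∀ (a : V) (l : X.Walk a a) (e : A), P a e → transport T l e = e :=
    fun a l e he => transport_homotopic hP hT hc (hX.2 a l) he
  have hrev : ∀ {a b : V} (p : X.Walk a b) (e : A), P a e →
      transport T p.reverse (transport T p e) = e := fun p e he => by
    rw [← transport_append]
    exact hloop _ _ _ he
  let w' : ∀ v, X.Walk x v := fun v => Classical.choice (hX.1.preconnected x v)
  refine ⟨fun v => transport T (w' v) e, hloop _ _ _ he, fun v => transport_mem hP _ he,
    fun a b hab => ?_⟩
  -- The loop runs from `b` back to `x`, out to `a`, then along the edge to `b`.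
  have h1 := hloop b ((w' b).reverse.append ((w' a).append (.cons hab .nil))) _
    (transport_mem hP (w' b) he)
  rw [transport_append, hrev _ _ he, transport_append] at h1
  exact h1

end Monodromy

/-! ### Continuation of germs, existence and uniqueness of the covering -/

section Continuation

variable {V W : Type*} {X : SimpleGraph V} {Y : SimpleGraph W}

/-- Isomorphisms between balls of radius `D` coincide with global isometries on balls of radius
`ρ`. -/
def ExtendsAt (X : SimpleGraph V) (ρ D : ℕ) : Prop :=
  ∀ (v : V) (φ : V → V), BallIso X X v D φ → ∃ g : X ≃g X, ∀ u ∈ ball X v ρ, g u = φ u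

/-- Every ball of radius `M` of `Y` is isomorphic to a ball of `X`. -/
def LocallyIso (X : SimpleGraph V) (Y : SimpleGraph W) (M : ℕ) : Prop :=
  ∀ y : W, ∃ (x : V) (φ : V → W), BallIso X Y x M φ ∧ φ x = y

/-- Composing `φ` with the inverse of a chart `ψ` of `Y` at `φ v` gives a ball isomorphism inside
`X`, hence an isometry `g` near `v`; then `ψ ∘ g` lives on the whole `M`-ball. -/
theorem BallIso.exists_continuation (hX : X.Connected) (hY : Y.Connected) {ρ D M : ℕ}
    (hρ : ρ ≤ D) (hM : D ≤ M) (hE : ExtendsAt X ρ D) (hL : LocallyIso X Y M) {v : V} {φ : V → W}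
    (hφ : BallIso X Y v D φ) : ∃ φ' : V → W, BallIso X Y v M φ' ∧ EqOn φ' φ (ball X v ρ) := by
  obtain ⟨u, ψ, hψ, hu⟩ := hL (φ v)
  obtain ⟨ψ', h1, h2, h3⟩ := hψ.exists_inverse hX hY
  rw [hu] at h1 h3
  obtain ⟨g, hg⟩ := hE v _ (hφ.comp hX hY (h1.mono hM))
  have hgv : g v = u := by
    rw [hg v (center_mem_ball X v ρ), Function.comp, ← hu, h2 u (center_mem_ball X u M)]
  refine ⟨ψ ∘ g, (BallIso.of_isom g v M).comp hX hX (by rwa [hgv]), fun z hz => ?_⟩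
  have hz' : X.dist v z ≤ D := le_trans hz hρ
  rw [Function.comp, hg z hz, Function.comp, h3]
  exact (hφ.dist_eq hX hY hz').le.trans (hz'.trans hM)

/-- On the `ρ`-ball, `φ` followed by the inverse of `φ'` is a global isometry; it fixes the
`rc`-ball, so it is the identity. -/
theorem BallIso.eqOn_of_eqOn (hX : X.Connected) (hY : Y.Connected) {rc ρ D : ℕ}
    (hrc : rc ≤ ρ) (hρ : ρ ≤ D) (hdet : ∀ (x : V) (g h : X ≃g X),
      (∀ u ∈ ball X x rc, g u = h u) → g = h) (hE : ExtendsAt X ρ D) {v : V} {φ φ' : V → W}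
    (hφ : BallIso X Y v D φ) (hφ' : BallIso X Y v D φ') (h : EqOn φ φ' (ball X v rc)) :
    EqOn φ φ' (ball X v ρ) := by
  obtain ⟨ψ, h1, h2, h3⟩ := hφ'.exists_inverse hX hY
  have hv : φ v = φ' v := h (center_mem_ball X v rc)
  rw [← hv] at h1 h3
  obtain ⟨g, hg⟩ := hE v _ (hφ.comp hX hY h1)
  have hg1 : g = RelIso.refl _ := hdet v _ _ fun u hu => by
    rw [hg u (ball_mono X v hrc hu), Function.comp, h hu,
      h2 u (ball_mono X v (hrc.trans hρ) hu), RelIso.refl_apply]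
  intro u hu
  have h4 := hg u hu
  rw [hg1, RelIso.refl_apply, Function.comp] at h4
  have h5 := h3 (φ u) ((hφ.dist_eq hX hY (le_trans hu hρ)).le.trans (le_trans hu hρ))
  rw [← h4] at h5
  exact h5.symm

/-- The graph of the restriction of `φ` to the ball of radius `r` around `v`. -/
def ballGerm (X : SimpleGraph V) (r : ℕ) (v : V) (φ : V → W) : Set (V × W) :=
  {z | z.1 ∈ ball X v r ∧ φ z.1 = z.2}

theorem ballGerm_eq_iff {r : ℕ} {v : V} {φ φ' : V → W} :
    ballGerm X r v φ = ballGerm X r v φ' ↔ EqOn φ φ' (ball X v r) := by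
  constructor
  · intro h u hu
    have : (u, φ u) ∈ ballGerm X r v φ := ⟨hu, rfl⟩
    rw [h] at this
    exact this.2.symm
  · intro h
    ext ⟨u, w⟩
    exact and_congr_right fun hu => by simp only; rw [h hu]

open Classical in
/-- Continuation of germs of ball isomorphisms of radius `D` from `a` to `b`. -/
noncomputable def continueGerm (X : SimpleGraph V) (Y : SimpleGraph W) (r D : ℕ) (a b : V)
    (e : Set (V × W)) : Set (V × W) :=
  if h : ∃ φ : V → W, BallIso X Y a D φ ∧ ballGerm X r a φ = e then
    ballGerm X r b h.choose else e

/-- A graph whose balls of radius `D` determine, and are determined by, global isometries. -/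
structure Rigid (X : SimpleGraph V) (rc D : ℕ) : Prop where
  conn : X.Connected
  lt : rc + 1 ≤ D
  det : ∀ (x : V) (g h : X ≃g X), (∀ u ∈ ball X x rc, g u = h u) → g = h
  ext : ExtendsAt X (rc + 1) D

/-- The chosen representative is irrelevant: an `rc`-germ determines the `(rc + 1)`-ball, which
contains the `rc`-ball of each neighbour. -/
theorem Rigid.continueGerm_eq {rc D : ℕ} (hX : Rigid X rc D) (hY : Y.Connected) {a b : V}
    (hab : X.Adj a b) {φ : V → W} (hφ : BallIso X Y a D φ) :
    continueGerm X Y rc D a b (ballGerm X rc a φ) = ballGerm X rc b φ := by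
  have h : ∃ φ' : V → W, BallIso X Y a D φ' ∧ ballGerm X rc a φ' = ballGerm X rc a φ :=
    ⟨φ, hφ, rfl⟩
  rw [continueGerm, dif_pos h, ballGerm_eq_iff]
  have h1 := h.choose_spec.1.eqOn_of_eqOn hX.conn hY (Nat.le_succ rc) hX.lt hX.det hX.ext hφ
    (ballGerm_eq_iff.1 h.choose_spec.2)
  refine h1.mono (ball_subset_ball hX.conn ?_)
  rw [SimpleGraph.dist_eq_one_iff_adj.2 hab, add_comm]

/-- The section `s` of germs is returned along with `p` because uniqueness compares another covering
with `s`. -/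
theorem Rigid.exists_covering {rc D M k r : ℕ} (hX : Rigid X rc D) (hk : KSimplyConnected X k)
    (hM : D + k + 1 ≤ M) (hY : Y.Connected) (hL : LocallyIso X Y M)
    {x : V} {f : V → W} (hf : BallIso X Y x (r + M) f) :
    ∃ p : V → W, IsCovering X Y p ∧ (∀ u ∈ ball X x r, p u = f u) ∧
      ∃ s : V → Set (V × W), s x = ballGerm X rc x f ∧ (∀ v, s v ⊆ {z | z.1 = v → z.2 = p v}) ∧
        ∀ a b, X.Adj a b → continueGerm X Y rc D a b (s a) = s b := by
  have hc := hX.conn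
  have hone : ∀ {a b : V}, X.Adj a b → X.dist a b = 1 := SimpleGraph.dist_eq_one_iff_adj.2
  let P : V → Set (V × W) → Prop := fun v e => ∃ φ, BallIso X Y v M φ ∧ ballGerm X rc v φ = e
  have hP : ∀ a b e, X.Adj a b → P a e → P b (continueGerm X Y rc D a b e) := by
    rintro a b _ hab ⟨φ, hφ, rfl⟩
    rw [hX.continueGerm_eq hY hab (hφ.mono (by omega))]
    -- Moving to `b` costs one unit of radius; since at least `D` remains, the germ extends back to
    -- radius `M`.
    obtain ⟨φ', h1, h2⟩ := (hφ.restrict hc (x' := b) (R' := D)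
      (by rw [hone hab]; omega)).exists_continuation hc hY hX.lt (by omega) hX.ext hL
    exact ⟨φ', h1, ballGerm_eq_iff.2 (h2.mono (ball_mono X b (Nat.le_succ rc)))⟩
  have hT : ∀ a b e, X.Adj a b → P a e →
      continueGerm X Y rc D b a (continueGerm X Y rc D a b e) = e := by
    rintro a b _ hab ⟨φ, hφ, rfl⟩
    rw [hX.continueGerm_eq hY hab (hφ.mono (by omega)),
      hX.continueGerm_eq hY hab.symm (hφ.restrict hc (by rw [hone hab]; omega))]
  have hloop : ∀ a e (l : X.Walk a a), P a e → l.length ≤ k →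
      transport (continueGerm X Y rc D) l e = e := by
    rintro a _ l ⟨φ, hφ, rfl⟩ hl
    -- The loop stays in the `k`-ball around `a`, where the single map `φ` still has radius `D`
    -- about every vertex.
    refine transport_eq_of_localSection (s := fun u => ballGerm X rc u φ) (S := ball X a k)
      (fun u w huw hu _ => hX.continueGerm_eq hY huw (hφ.restrict hc ?_)) l fun u hu => ?_
    · have : X.dist a u ≤ k := hu
      omega
    · classical
      exact (SimpleGraph.dist_le (l.takeUntil u hu)).trans
        ((l.length_takeUntil_le_length hu).trans hl)
  obtain ⟨s, hsx, hsP, hsT⟩ := exists_section hk hP hT hloop x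
    ⟨f, hf.mono (by omega), rfl⟩
  choose φ hφ hsφ using hsP
  have hstar : ∀ a b, X.Adj a b → φ a b = φ b b := by
    intro a b hab
    have h1 := hsT a b hab
    rw [← hsφ a, ← hsφ b, hX.continueGerm_eq hY hab ((hφ a).mono (by omega)),
      ballGerm_eq_iff] at h1
    exact h1 (center_mem_ball X b rc)
  have hEq : ∀ a, EqOn (φ a) (fun v => φ v v) (X.neighborSet a) := fun a b hab => hstar a b hab
  have himage : ∀ a, (fun v => φ v v) '' X.neighborSet a = Y.neighborSet (φ a a) := fun a => by
    rw [← (hEq a).image_eq, (hφ a).1 a (by rw [SimpleGraph.dist_self]; omega)]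
  -- Up to distance `r` from `x`, `f` is itself a ball isomorphism of radius at least `M`, so the
  -- section consists of its germs.
  have hball : ∀ n, ∀ u, X.dist x u = n → n ≤ r → s u = ballGerm X rc u f := by
    intro n
    induction n with
    | zero =>
      intro u hu _
      obtain rfl := (hc.dist_eq_zero_iff).1 hu
      exact hsx
    | succ n ih =>
      intro u hu hn
      obtain ⟨w, hw, hd⟩ := exists_adj_dist_eq hc hu
      rw [← hsT w u hw, ih w hd (by omega),
        hX.continueGerm_eq hY hw (hf.restrict hc (by omega))]
  refine ⟨fun v => φ v v, ⟨surjective_of_image_neighborSet hc hY himage, fun a => ?_⟩,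
    fun u hu => ?_, s, hsx, fun v => ?_, hsT⟩
  · rw [← himage a]
    refine InjOn.bijOn_image (((hφ a).2.mono fun b hb => ?_).congr (hEq a))
    have : X.dist a b = 1 := hone hb
    exact show X.dist a b ≤ M by omega
  · have h1 := hball _ u rfl hu
    rw [← hsφ u, ballGerm_eq_iff] at h1
    exact h1 (center_mem_ball X u rc)
  · rw [← hsφ v]
    rintro ⟨z, w⟩ ⟨-, hw⟩ hz
    simp only at hw hz ⊢
    rw [← hw, hz]

/-- Coverings of a graph that is locally a rigid graph are local isomorphisms. -/
theorem Rigid.ballIso_of_isCovering {rc D M : ℕ} (hX : Rigid X rc D)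
    (hfin : ∀ u, (X.neighborSet u).Finite) (hM : D + 1 ≤ M) (hY : Y.Connected)
    (hL : LocallyIso X Y M) {q : V → W} (hq : IsCovering X Y q) (v : V) : BallIso X Y v M q := by
  have hc := hX.conn
  -- `q` maps the `M`-ball at `v` onto that at `q v`, which has as many points as the ball at `u`;
  -- if the source is no larger, `q` is injective on it.
  have hballs : ∀ {v u : V} {φ : V → W}, BallIso X Y u M φ → φ u = q v →
      (ball X v M).ncard ≤ (ball X u M).ncard → BallIso X Y v M q := by
    intro v u φ hφ hu hle
    refine ⟨hq.coversBall v M, Set.injOn_of_ncard_image_eq ?_ (ball_finite hc hfin v M)⟩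
    refine le_antisymm (ncard_image_le (ball_finite hc hfin v M)) ?_
    rw [(hq.coversBall v M).image_ball hc hY, ← hu, ← hφ.1.image_ball hc hY, hφ.2.ncard_image]
    exact hle
  have := hc.nonempty
  -- At a centre whose ball has least cardinality the comparison is automatic; the property then
  -- spreads along edges.
  obtain ⟨v₀, hv₀⟩ : ∃ v₀, ∀ u, (ball X v₀ M).ncard ≤ (ball X u M).ncard :=
    ⟨_, fun u => Function.argmin_le (fun v => (ball X v M).ncard) u⟩
  obtain ⟨w⟩ := hc.preconnected v₀ v
  have h₀ : BallIso X Y v₀ M q := by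
    obtain ⟨u, φ, hφ, hu⟩ := hL (q v₀)
    exact hballs hφ hu (hv₀ u)
  clear hv₀
  induction w with
  | nil => exact h₀
  | @cons a b _ hab _ ih =>
    refine ih ?_
    -- Continuing `q` gives a chart centred at `b` itself, so the two balls being counted coincide.
    obtain ⟨φ, hφ, he⟩ := (h₀.restrict hc (x' := b) (R' := D)
      (by rw [SimpleGraph.dist_eq_one_iff_adj.2 hab]; omega)).exists_continuation hc hY hX.lt
      (by omega) hX.ext hL
    exact hballs hφ (he (center_mem_ball X b _)) le_rfl

theorem Rigid.existsUnique_covering {rc D M k r : ℕ} (hX : Rigid X rc D)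
    (hfin : ∀ u, (X.neighborSet u).Finite) (hk : KSimplyConnected X k)
    (hM : D + k + 1 ≤ M) (hr : rc ≤ r) (hY : Y.Connected) (hL : LocallyIso X Y M)
    {x : V} {f : V → W} (hf : BallIso X Y x (r + M) f) :
    ∃! p : V → W, IsCovering X Y p ∧ ∀ u ∈ ball X x r, p u = f u := by
  obtain ⟨p, hp, hpf, s, hsx, hsp, hsT⟩ := hX.exists_covering hk hM hY hL hf
  refine ⟨p, ⟨hp, hpf⟩, fun q ⟨hq, hqf⟩ => funext fun v => ?_⟩
  have hqM := hX.ballIso_of_isCovering hfin (by omega) hY hL hq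
  have hx : ballGerm X rc x q = s x := by
    rw [hsx, ballGerm_eq_iff]
    exact fun u hu => hqf u (ball_mono X x hr hu)
  have hwalk : ∀ {a b : V}, X.Walk a b → ballGerm X rc a q = s a → ballGerm X rc b q = s b := by
    intro a b w ha
    induction w with
    | nil => exact ha
    | @cons a b _ hab _ ih =>
      refine ih ?_
      rw [← hsT a b hab, ← ha, hX.continueGerm_eq hY hab ((hqM a).mono (by omega))]
  obtain ⟨w⟩ := hX.conn.preconnected x v
  have hv := hwalk w hx
  have hmem : (v, q v) ∈ s v := by
    rw [← hv]
    exact ⟨center_mem_ball X v rc, rfl⟩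
  exact hsp v hmem rfl

end Continuation

/-! ### Finite stabilizers, discreteness and rigidity -/

section Stabilizers

variable {V : Type u} {X : SimpleGraph V}

/-- Isometries are determined by their values on some finite set of vertices. -/
def FinitelyDetermined (X : SimpleGraph V) : Prop :=
  ∃ S : Set V, S.Finite ∧ ∀ g : X ≃g X, (∀ u ∈ S, g u = u) → g = RelIso.refl _

/-- An element fixing `x` preserves distances to `x`, so its restriction to `S` takes finitely many
values. -/
theorem FinitelyDetermined.finiteStabilizers (hX : X.Connected)
    (hfin : ∀ u, (X.neighborSet u).Finite) (h : FinitelyDetermined X) : FiniteStabilizers X := by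
  obtain ⟨S, hS, hdet⟩ := h
  intro x
  have := hS.to_subtype
  have hb : ∀ u : S, Finite (ball X x (X.dist x u)) := fun u =>
    (ball_finite hX hfin x _).to_subtype
  have hmaps : ∀ (g : MulAction.stabilizer (Isom X) x) (u : S),
      (g : Isom X) (u : V) ∈ ball X x (X.dist x u) := fun g u => by
    have h1 := (BallIso.of_isom (g : Isom X) x (X.dist x u)).dist_eq hX hX le_rfl
    have h2 : (g : Isom X) x = x := g.2
    rw [h2] at h1
    exact h1.le
  refine Finite.of_injective
    (fun (g : MulAction.stabilizer (Isom X) x) (u : S) =>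
      (⟨(g : Isom X) (u : V), hmaps g u⟩ : ball X x (X.dist x u))) fun g g' he => ?_
  have h1 : ((g : Isom X).trans (g' : Isom X).symm : X ≃g X) = RelIso.refl _ := by
    refine hdet _ fun u hu => ?_
    have h2 := congrArg Subtype.val (congrFun he ⟨u, hu⟩)
    simp only at h2
    rw [RelIso.trans_apply, h2, RelIso.symm_apply_apply]
  refine Subtype.ext (RelIso.ext fun u => ?_)
  have h3 := DFunLike.congr_fun h1 u
  rw [RelIso.trans_apply, RelIso.refl_apply] at h3
  rw [← (g' : Isom X).apply_symm_apply ((g : Isom X) u), h3]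

/-- Take `x` and one moved vertex for each nontrivial element of its stabilizer. -/
theorem FiniteStabilizers.finitelyDetermined (hX : X.Connected) (h : FiniteStabilizers X) :
    FinitelyDetermined X := by
  obtain ⟨x⟩ := hX.nonempty
  have := h x
  have hm : ∀ g : Isom X, ∃ u, g ≠ RelIso.refl _ → g u ≠ u := fun g => by
    by_contra! hcon
    exact (hcon x).1 (RelIso.ext fun u => (hcon u).2)
  choose m hm using hm
  refine ⟨insert x (range fun g : MulAction.stabilizer (Isom X) x => m g),
    (finite_range _).insert x, fun g hg => ?_⟩
  by_contra hne
  exact hm g hne (hg _ (Or.inr ⟨⟨g, hg x (Or.inl rfl)⟩, rfl⟩))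

/-- Pointwise stabilizers of finite sets form a neighbourhood basis of the identity. -/
theorem discreteIsom_iff_finitelyDetermined : DiscreteIsom X ↔ FinitelyDetermined X := by
  let _ : TopologicalSpace V := ⊥
  have : DiscreteTopology V := ⟨rfl⟩
  let _ : TopologicalSpace (Isom X) := isomTopology X
  constructor
  · intro h
    have : DiscreteTopology (Isom X) := h
    obtain ⟨O, hO, hO1⟩ := isOpen_induced_iff.1 (isOpen_discrete ({RelIso.refl _} : Set (Isom X)))
    have hmem : (fun x : V => x) ∈ O := by
      have : (RelIso.refl _ : Isom X) ∈ (fun (g : Isom X) (x : V) => g x) ⁻¹' O := by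
        rw [hO1]
        rfl
      exact this
    obtain ⟨I, t, ht, hsub⟩ := isOpen_pi_iff.1 hO _ hmem
    refine ⟨I, I.finite_toSet, fun g hg => ?_⟩
    have : g ∈ (fun (g : Isom X) (x : V) => g x) ⁻¹' O := hsub fun u hu => by
      change g u ∈ t u
      rw [hg u hu]
      exact (ht u hu).2
    rw [hO1] at this
    exact this
  · rintro ⟨S, hS, hdet⟩
    refine discreteTopology_iff_isOpen_singleton.2 fun g => isOpen_induced_iff.2
      ⟨S.pi fun u => {g u}, isOpen_set_pi hS fun u _ => isOpen_discrete _, ?_⟩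
    ext h
    constructor
    · intro hh
      have h1 : (h : X ≃g X).trans g.symm = RelIso.refl _ := hdet _ fun u hu => by
        have h2 : h u = g u := hh u hu
        rw [RelIso.trans_apply, h2, RelIso.symm_apply_apply]
      refine RelIso.ext fun u => ?_
      have h3 := DFunLike.congr_fun h1 u
      rw [RelIso.trans_apply, RelIso.refl_apply] at h3
      rw [← g.apply_symm_apply (h u), h3]
    · rintro rfl u _
      rfl

theorem FinitelyDetermined.exists_determinedOnBalls (hX : X.Connected) (hcoc : CocompactIsom X)
    (h : FinitelyDetermined X) : ∃ rc, DeterminedOnBalls X rc := by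
  obtain ⟨S, hS, hdet⟩ := h
  obtain ⟨F, hF, hFX⟩ := hcoc.exists_finite
  -- With this bound, the `rc`-ball at each orbit representative contains `S`.
  obtain ⟨rc, hrc⟩ := ((hF.prod hS).image fun z => X.dist z.1 z.2).bddAbove
  refine ⟨rc, fun x g h hgh => ?_⟩
  obtain ⟨a, ha, γ, hγ⟩ := hFX x
  have h1 : (γ.symm.trans (g.trans h.symm)).trans γ = RelIso.refl _ := hdet _ fun u hu => by
    have hu' : γ.symm u ∈ ball X x rc := by
      have h2 := (BallIso.of_isom γ.symm a _).dist_eq hX hX (le_refl (X.dist a u))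
      have h3 : γ.symm a = x := by rw [← hγ, RelIso.symm_apply_apply]
      rw [h3] at h2
      exact h2.le.trans (hrc ⟨(a, u), ⟨ha, hu⟩, rfl⟩)
    simp only [RelIso.trans_apply]
    rw [hgh _ hu', RelIso.symm_apply_apply, RelIso.apply_symm_apply]
  refine RelIso.ext fun u => ?_
  have h3 := DFunLike.congr_fun h1 (γ u)
  simp only [RelIso.trans_apply, RelIso.symm_apply_apply, RelIso.refl_apply] at h3
  rw [← h.apply_symm_apply (g u), γ.injective h3]

theorem isBallIsometry_refl (X : SimpleGraph V) (x : V) (R : ℕ) :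
    IsBallIsometry X X x x R (Equiv.refl _) :=
  ⟨rfl, fun _ _ => rfl⟩

theorem USLGRigidAt.finitelyDetermined (hX : X.Connected) (hfin : ∀ u, (X.neighborSet u).Finite)
    {r R : ℕ} (h : USLGRigidAt X r R) : FinitelyDetermined X := by
  obtain ⟨x⟩ := hX.nonempty
  refine ⟨ball X x r, ball_finite hX hfin x r, fun g hg => ?_⟩
  have hcov : ∀ g : X ≃g X, IsCovering X X g := fun g => ⟨g.surjective, fun u => by
    have h1 := (BallIso.of_isom g u 1).1 u (by simp)
    rw [← h1]
    exact g.injective.injOn.bijOn_image⟩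
  have h1 := (h V X hX hfin (fun y => ⟨y, _, isBallIsometry_refl X y R⟩) x x _
    (isBallIsometry_refl X x R)).unique (y₁ := g) (y₂ := (RelIso.refl _ : X ≃g X))
    ⟨hcov g, fun u hu => hg u hu⟩ ⟨hcov _, fun _ _ => rfl⟩
  exact RelIso.ext fun u => congrFun h1 u

theorem DeterminedOnBalls.exists_uslgRigidAt (hX : X.Connected)
    (hfin : ∀ u, (X.neighborSet u).Finite) (hsc : LargeScaleSimplyConnected X)
    (hcoc : CocompactIsom X) {rc : ℕ} (h : DeterminedOnBalls X rc) :
    ∃ C : ℕ, 0 < C ∧ ∀ r : ℕ, rc ≤ r → USLGRigidAt X r (r + C) := by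
  obtain ⟨k, hk⟩ := hsc
  obtain ⟨F, hF, hFX⟩ := hcoc.exists_finite
  obtain ⟨D, hD, hE⟩ := exists_extension_radius hX hfin hF hFX (rc + 1)
  have hrigid : Rigid X rc D := ⟨hX, hD, h, hE⟩
  -- Loops of length at most `k` need room `D + k`; the extra unit allows one edge step even when `k
  -- = 0`.
  refine ⟨D + k + 1, by omega, fun r hr W Y hY _ hL x y f hf => ?_⟩
  obtain ⟨φ, hφ, -, hφf⟩ := hf.exists_ballIso hX hY
  have hloc : LocallyIso X Y (D + k + 1) := fun z => by
    obtain ⟨u, ψ, hψ, hz⟩ := hL.exists_ballIso hX hY z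
    exact ⟨u, ψ, hψ.mono (by omega), hz⟩
  have hiff : ∀ p : V → W, (∀ u : ball X x (r + (D + k + 1)), X.dist x u ≤ r → p u = f u) ↔
      ∀ u ∈ ball X x r, p u = φ u := fun p =>
    ⟨fun hp u hu => (hp ⟨u, ball_mono X x (Nat.le_add_right _ _) hu⟩ hu).trans (hφf _).symm,
      fun hp u hu => (hp u hu).trans (hφf u)⟩
  simp only [hiff]
  exact hrigid.existsUnique_covering hfin hk le_rfl hr hY hloc hφ

end Stabilizers
end LocalGlobal

theorem mainTheorem1 {V : Type u} (X : SimpleGraph V) (hconn : X.Connected)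
    (hfin : ∀ x, (X.neighborSet x).Finite)
    (hsc : LocalGlobal.LargeScaleSimplyConnected X)
    (hcoc : LocalGlobal.CocompactIsom X) :
    (LocalGlobal.USLGRigid X ↔ LocalGlobal.FiniteStabilizers X) ∧
    (LocalGlobal.FiniteStabilizers X ↔ LocalGlobal.DiscreteIsom X) ∧
    (LocalGlobal.DiscreteIsom X → ∃ rc : ℕ, LocalGlobal.DeterminedOnBalls X rc) ∧
    ∀ rc : ℕ, LocalGlobal.DeterminedOnBalls X rc →
      ∃ C : ℕ, 0 < C ∧ ∀ r : ℕ, rc ≤ r → LocalGlobal.USLGRigidAt X r (r + C) := by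
  refine ⟨⟨?_, fun h => ?_⟩, ?_, fun h => ?_,
    fun rc h => h.exists_uslgRigidAt hconn hfin hsc hcoc⟩
  · rintro ⟨r, h⟩
    obtain ⟨R, -, hR⟩ := h r le_rfl
    exact (hR.finitelyDetermined hconn hfin).finiteStabilizers hconn hfin
  · obtain ⟨rc, hrc⟩ := (h.finitelyDetermined hconn).exists_determinedOnBalls hconn hcoc
    obtain ⟨C, -, hC⟩ := hrc.exists_uslgRigidAt hconn hfin hsc hcoc
    exact ⟨rc, fun r hr => ⟨r + C, Nat.le_add_right r C, hC r hr⟩⟩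
  · rw [LocalGlobal.discreteIsom_iff_finitelyDetermined]
    exact ⟨fun h => h.finitelyDetermined hconn, fun h => h.finiteStabilizers hconn hfin⟩
  · exact (LocalGlobal.discreteIsom_iff_finitelyDetermined.1 h).exists_determinedOnBalls hconn hcoc
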